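/- Let $0<T<\infty$, $\Omega=\{(x,t): 0\le x<\infty,\ 0\le t<T\}$, and let $u:\Omega\to\mathbb R$ be a $C^3$ solution of the Degasperis–Procesi equation $u_t-u_{txx}+3u_x+4uu_x-3u_xu_{xx}-uu_{xxx}=0$ such that $u,u_x,u_{xx}\to0$ as $x\to\infty$ for each $t$, $u(x,0)-u_{xx}(x,0)+1>0$ for $x\ge0$ and $u(0,t)-u_{xx}(0,t)+1>0$ for $0\le t<T$. Put $q=(u-u_{xx}+1)^{1/3}$, $\omega=e^{2\pi i/3}$, $\lambda(k)=\frac{1}{3\sqrt3}(k^3+k^{-3})$ and, for $j=1,2,3$, $$l_j(k)=\tfrac1{\sqrt3}\Bigl(\omega^jk+\tfrac1{\omega^jk}\Bigr),\qquad z_j(k)=\sqrt3\,\frac{(\omega^jk)^2+(\omega^jk)^{-2}}{k^3+k^{-3}},$$ $\mathcal L=\mathrm{diag}(l_1,l_2,l_3)$, $\mathcal Z=\mathrm{diag}(z_1,z_2,z_3)$, $P(k)=\bigl(l_j(k)^{i-1}\bigr)_{i,j=1}^3$, $$V_1=P^{-1}\begin{pmatrix}0&0&0\\0&0&0\\ \lambda(q^3-1)&0&0\end{pmatrix}P,\qquad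 V_2=P^{-1}\begin{pmatrix}u_x&-u&0\\u&0&-u\\u_x-\lambda uq^3&0&-u_x\end{pmatrix}P .$$ Write $e^{\hat D}M=e^DMe^{-D}$ for diagonal $D$. For permutations $(a,b,c)$ and $(a',b',c')$ of $(1,2,3)$ let $D_{abc|a'b'c'}$ be the set of $k\in\mathbb C\setminus\{0\}$ with $k^3+k^{-3}\ne0$, $\mathrm{Re}\,l_a<\mathrm{Re}\,l_b<\mathrm{Re}\,l_c$ and $\mathrm{Re}\,z_{a'}<\mathrm{Re}\,z_{b'}<\mathrm{Re}\,z_{c'}$. The sets $D_1,\dots,D_{18}$ are those with the following indices, in this order: $123|123$, $132|132$, $312|312$, $321|321$, $231|231$, $213|213$, $123|213$, $123|132$, $132|123$, $132|312$, $312|132$, $312|321$, $321|312$, $321|231$, $231|321$, $231|213$, $213|231$, $213|123$. Let $\gamma_1$ be the path $(0,T)\to(0,t)\to(x,t)$, $\gamma_2$ the path $(0,0)\to(0,t)\to(x,t)$ and $\gamma_3$ the path $(\infty,t)\to(x,t)$, all made of straight segments. For $k\in D_n$ put $\gamma^n_{ij}=\gamma_1$ if $\mathrm{Re}\,l_i<\mathrm{Re}\,l_j$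 and $\mathrm{Re}\,z_i\ge\mathrm{Re}\,z_j$, $\gamma^n_{ij}=\gamma_2$ if $\mathrm{Re}\,l_i<\mathrm{Re}\,l_j$ and $\mathrm{Re}\,z_i<\mathrm{Re}\,z_j$, and $\gamma^n_{ij}=\gamma_3$ if $\mathrm{Re}\,l_i\ge\mathrm{Re}\,l_j$. For $k\in D_n$, $\Phi_n(\cdot,\cdot,k):\Omega\to\mathbb C^{3\times3}$ is the solution, bounded in $x$ for each $t$, of the Lax pair $\Phi_x-[\mathcal L,\Phi]=V_1\Phi$, $\Phi_t-[\mathcal Z,\Phi]=V_2\Phi$ that satisfies the integral equations (with absolutely convergent integrals) $$(\Phi_n)_{ij}(x,t,k)=\delta_{ij}+\int_{\gamma^n_{ij}}\Bigl(e^{\hat{\mathcal L}(k)x+\hat{\mathcal Z}(k)t}\,e^{-\hat{\mathcal L}(k)x'-\hat{\mathcal Z}(k)t'}\bigl[(V_1\,dx'+V_2\,dt')\Phi_n\bigr](x',t',k)\Bigr)_{ij},\qquad i,j=1,2,3 ;$$ it is well-defined at those $k\in D_n$ at which such a solution exists and is unique. Let $\Phi_*=\Phi_n$ on the set of $k\in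 D_n$ at which $\Phi_n$ is well-defined, $n=1,\dots,18$, and let $\mathcal D\subset\mathbb C$ be the resulting domain of $\Phi_*$ in $k$. Let $$\mathcal A=\begin{pmatrix}0&0&1\\1&0&0\\0&1&0\end{pmatrix},\qquad \mathcal B=\begin{pmatrix}0&1&0\\1&0&0\\0&0&1\end{pmatrix}.$$ Then, for every $k\in\mathcal D$, also $\omega k,\ \bar k,\ 1/k\in\mathcal D$, and for all $(x,t)\in\Omega$ $$\Phi_*(x,t,k)=\mathcal A\,\Phi_*(x,t,\omega k)\,\mathcal A^{-1},\qquad \Phi_*(x,t,k)=\mathcal B\,\overline{\Phi_*(x,t,\bar k)}\,\mathcal B,\qquad \Phi_*(x,t,k)=\mathcal B\,\Phi_*(x,t,1/k)\,\mathcal B .$$ -/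

import Mathlib

open scoped Matrix ComplexConjugate

noncomputable section

namespace DPHalfLine

/-! The indices `1, 2, 3` of the mathematics are the elements `0, 1, 2` of `Fin 3`. -/

/-- Complex `3 × 3` matrices. -/
abbrev Mat3 := Matrix (Fin 3) (Fin 3) ℂ

/-- The half-line domain `0 ≤ x < ∞`, `0 ≤ t < T`, with points `(x, t)`. -/
def Omega (T : ℝ) : Set (ℝ × ℝ) := Set.Ici 0 ×ˢ Set.Ico 0 T

/-- Partial derivative in `x` on `0 ≤ x < ∞` (one-sided at `x = 0`). -/
def dx (f : ℝ → ℝ → ℝ) (x t : ℝ) : ℝ := derivWithin (fun x' => f x' t) (Set.Ici 0) x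

/-- Partial derivative in `t` on `0 ≤ t < T` (one-sided at `t = 0`). -/
def dt (T : ℝ) (f : ℝ → ℝ → ℝ) (x t : ℝ) : ℝ := derivWithin (fun t' => f x t') (Set.Ico 0 T) t

/-- `u` is a classical solution of the Degasperis-Procesi equation with `κ = 1` on the half-line
domain, decaying as `x → ∞`, whose initial and boundary values satisfy the positivity
conditions `u₀ - u₀'' + 1 > 0` and `g₀ - g₂ + 1 > 0`. -/
structure IsDPSolution (T : ℝ) (u : ℝ → ℝ → ℝ) : Prop where
  contDiffOn : ContDiffOn ℝ 3 (fun p : ℝ × ℝ => u p.1 p.2) (Omega T)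
  equation : ∀ x t : ℝ, (x, t) ∈ Omega T →
    dt T u x t - dx (dx (dt T u)) x t + 3 * dx u x t + 4 * u x t * dx u x t
      - 3 * dx u x t * dx (dx u) x t - u x t * dx (dx (dx u)) x t = 0
  decay : ∀ t ∈ Set.Ico 0 T, Filter.Tendsto (fun x => u x t) Filter.atTop (nhds 0)
  decay_dx : ∀ t ∈ Set.Ico 0 T, Filter.Tendsto (fun x => dx u x t) Filter.atTop (nhds 0)
  decay_dxx : ∀ t ∈ Set.Ico 0 T, Filter.Tendsto (fun x => dx (dx u) x t) Filter.atTop (nhds 0)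
  pos_initial : ∀ x : ℝ, 0 ≤ x → 0 < u x 0 - dx (dx u) x 0 + 1
  pos_boundary : ∀ t ∈ Set.Ico 0 T, 0 < u 0 t - dx (dx u) 0 t + 1

/-- `q = (u - u_xx + 1)^(1/3)`. -/
def q (u : ℝ → ℝ → ℝ) (x t : ℝ) : ℝ := (u x t - dx (dx u) x t + 1) ^ (1 / 3 : ℝ)

/-- `ω = exp(2πi/3)`. -/
def omega : ℂ := Complex.exp (2 * Real.pi * Complex.I / 3)

/-- `λ(k) = (k³ + k⁻³) / (3√3)`. -/
def lam (k : ℂ) : ℂ := 1 / (3 * (Real.sqrt 3 : ℂ)) * (k ^ 3 + 1 / k ^ 3)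

/-- `l_j(k) = (ω^j k + (ω^j k)⁻¹) / √3`. -/
def l (k : ℂ) (j : Fin 3) : ℂ :=
  1 / (Real.sqrt 3 : ℂ) * (omega ^ (j.val + 1) * k + 1 / (omega ^ (j.val + 1) * k))

/-- `z_j(k) = √3 ((ω^j k)² + (ω^j k)⁻²) / (k³ + k⁻³)`. -/
def z (k : ℂ) (j : Fin 3) : ℂ :=
  (Real.sqrt 3 : ℂ) * (((omega ^ (j.val + 1) * k) ^ 2 + 1 / (omega ^ (j.val + 1) * k) ^ 2) /
    (k ^ 3 + 1 / k ^ 3))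

/-- The matrix `P(k)` with rows `(1, 1, 1)`, `(l₁, l₂, l₃)`, `(l₁², l₂², l₃²)`. -/
def P (k : ℂ) : Mat3 := Matrix.of fun i j => l k j ^ i.val

/-- `V₁`, the `x`-potential of the transformed Lax pair. -/
def V1 (u : ℝ → ℝ → ℝ) (x t : ℝ) (k : ℂ) : Mat3 :=
  (P k)⁻¹ * !![0, 0, 0; 0, 0, 0; lam k * ((q u x t : ℂ) ^ 3 - 1), 0, 0] * P k

/-- `V₂`, the `t`-potential of the transformed Lax pair. -/
def V2 (u : ℝ → ℝ → ℝ) (x t : ℝ) (k : ℂ) : Mat3 :=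
  (P k)⁻¹ * !![(dx u x t : ℂ), -(u x t : ℂ), 0;
               (u x t : ℂ), 0, -(u x t : ℂ);
               (dx u x t : ℂ) - lam k * (u x t : ℂ) * (q u x t : ℂ) ^ 3, 0, -(dx u x t : ℂ)] * P k

/-- `e^{D̂} M = e^D M e^{-D}` for the diagonal matrix `D = diag(d)`. -/
def expHat (d : Fin 3 → ℂ) (M : Mat3) : Mat3 :=
  Matrix.diagonal (fun i => Complex.exp (d i)) * M * Matrix.diagonal (fun i => Complex.exp (-d i))

/-- The diagonal of `x 𝓛(k) + t 𝓩(k)`. -/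
def phase (x t : ℝ) (k : ℂ) (i : Fin 3) : ℂ := l k i * x + z k i * t

/-- The `dx`-component of the one-form `W = e^{-x𝓛̂ - t𝓩̂} (V₁ dx + V₂ dt) Φ`. -/
def W1 (u : ℝ → ℝ → ℝ) (Φ : ℝ → ℝ → Mat3) (x t : ℝ) (k : ℂ) : Mat3 :=
  expHat (-phase x t k) (V1 u x t k * Φ x t)

/-- The `dt`-component of the one-form `W = e^{-x𝓛̂ - t𝓩̂} (V₁ dx + V₂ dt) Φ`. -/
def W2 (u : ℝ → ℝ → ℝ) (Φ : ℝ → ℝ → Mat3) (x t : ℝ) (k : ℂ) : Mat3 :=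
  expHat (-phase x t k) (V2 u x t k * Φ x t)

/-- The three contours `γ₁, γ₂, γ₃`. Those ending at `(x, t)` are
`γ₁ : (0, T) → (0, t) → (x, t)`, `γ₂ : (0, 0) → (0, t) → (x, t)` and `γ₃ : (∞, t) → (x, t)`,
all composed of straight segments. -/
inductive Contour
  | one
  | two
  | three

/-- The integral of the one-form `f dx' + g dt'` along a contour ending at `(x, t)`. -/
def contourIntegral (T : ℝ) (γ : Contour) (f g : ℝ → ℝ → ℂ) (x t : ℝ) : ℂ :=
  match γ with
  | Contour.one => (∫ t' in T..t, g 0 t') + ∫ x' in (0 : ℝ)..x, f x' t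
  | Contour.two => (∫ t' in (0 : ℝ)..t, g 0 t') + ∫ x' in (0 : ℝ)..x, f x' t
  | Contour.three => -∫ x' in Set.Ioi x, f x' t

/-- Absolute convergence of the integral of `f dx' + g dt'` along a contour ending at `(x, t)`. -/
def ContourIntegrable (T : ℝ) (γ : Contour) (f g : ℝ → ℝ → ℂ) (x t : ℝ) : Prop :=
  match γ with
  | Contour.one => IntervalIntegrable (fun t' => g 0 t') MeasureTheory.volume T t ∧
      IntervalIntegrable (fun x' => f x' t) MeasureTheory.volume 0 x
  | Contour.two => IntervalIntegrable (fun t' => g 0 t') MeasureTheory.volume 0 t ∧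
      IntervalIntegrable (fun x' => f x' t) MeasureTheory.volume 0 x
  | Contour.three => MeasureTheory.IntegrableOn (fun x' => f x' t) (Set.Ioi x)

open Classical in
/-- The contour `γ_{ij}` attached to the entry `(i, j)`; it is constant for `k` in each `D n`. -/
def contour (k : ℂ) (i j : Fin 3) : Contour :=
  if (l k i).re < (l k j).re then
    if (z k j).re ≤ (z k i).re then Contour.one else Contour.two
  else Contour.three

/-- `Re f_a < Re f_b < Re f_c` for `p = (a, b, c)`. -/
def Ordered (f : Fin 3 → ℂ) (p : Fin 3 × Fin 3 × Fin 3) : Prop :=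
  (f p.1).re < (f p.2.1).re ∧ (f p.2.1).re < (f p.2.2).re

/-- For `D₁, …, D₁₈`: the indices listed by increasing real part of the `l_j`. -/
def lOrder : Fin 18 → Fin 3 × Fin 3 × Fin 3 :=
  ![(0, 1, 2), (0, 2, 1), (2, 0, 1), (2, 1, 0), (1, 2, 0), (1, 0, 2),
    (0, 1, 2), (0, 1, 2), (0, 2, 1), (0, 2, 1), (2, 0, 1), (2, 0, 1),
    (2, 1, 0), (2, 1, 0), (1, 2, 0), (1, 2, 0), (1, 0, 2), (1, 0, 2)]

/-- For `D₁, …, D₁₈`: the indices listed by increasing real part of the `z_j`. -/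
def zOrder : Fin 18 → Fin 3 × Fin 3 × Fin 3 :=
  ![(0, 1, 2), (0, 2, 1), (2, 0, 1), (2, 1, 0), (1, 2, 0), (1, 0, 2),
    (1, 0, 2), (0, 2, 1), (0, 1, 2), (2, 0, 1), (0, 2, 1), (2, 1, 0),
    (2, 0, 1), (1, 2, 0), (2, 1, 0), (1, 0, 2), (1, 2, 0), (0, 1, 2)]

/-- The sets `D₁, …, D₁₈`. The poles of the `l_j` and `z_j` (`0`, `∞` and the zeros of `λ`) are
not in any of them: at `0` all the values `l k j`, and at the zeros of `λ` all the values `z k j`,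
are `0` by convention, so that the strict inequalities fail. -/
def D (n : Fin 18) : Set ℂ := {k | Ordered (l k) (lOrder n) ∧ Ordered (z k) (zOrder n)}

/-- `Φ` is, for the spectral parameter `k`, an eigenfunction: a solution on the half-line domain of
the Lax pair `Φ_x - [𝓛, Φ] = V₁ Φ`, `Φ_t - [𝓩, Φ] = V₂ Φ` and of the integral equations
`Φ_ij = δ_ij + ∫_{γ_ij} (e^{x𝓛̂ + t𝓩̂} W)_ij` (the integrals converging absolutely),
bounded in `x` for each `t`. -/
structure IsEigenfunction (T : ℝ) (u : ℝ → ℝ → ℝ) (k : ℂ) (Φ : ℝ → ℝ → Mat3) : Prop where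
  lax_x : ∀ x t : ℝ, (x, t) ∈ Omega T → ∀ i j : Fin 3,
    HasDerivWithinAt (fun x' => Φ x' t i j)
      ((Matrix.diagonal (l k) * Φ x t - Φ x t * Matrix.diagonal (l k)
        + V1 u x t k * Φ x t) i j) (Set.Ici 0) x
  lax_t : ∀ x t : ℝ, (x, t) ∈ Omega T → ∀ i j : Fin 3,
    HasDerivWithinAt (fun t' => Φ x t' i j)
      ((Matrix.diagonal (z k) * Φ x t - Φ x t * Matrix.diagonal (z k)
        + V2 u x t k * Φ x t) i j) (Set.Ico 0 T) t
  bounded : ∀ t ∈ Set.Ico 0 T, ∃ C : ℝ, ∀ x : ℝ, 0 ≤ x → ∀ i j : Fin 3, ‖Φ x t i j‖ ≤ C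
  integrable : ∀ x t : ℝ, (x, t) ∈ Omega T → ∀ i j : Fin 3,
    ContourIntegrable T (contour k i j)
      (fun x' t' => expHat (phase x t k) (W1 u Φ x' t' k) i j)
      (fun x' t' => expHat (phase x t k) (W2 u Φ x' t' k) i j) x t
  integral_eq : ∀ x t : ℝ, (x, t) ∈ Omega T → ∀ i j : Fin 3,
    Φ x t i j = (1 : Mat3) i j + contourIntegral T (contour k i j)
      (fun x' t' => expHat (phase x t k) (W1 u Φ x' t' k) i j)
      (fun x' t' => expHat (phase x t k) (W2 u Φ x' t' k) i j) x t

/-- The eigenfunction at `k` is well-defined: it exists, and it is unique on the domain. -/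
def WellDefined (T : ℝ) (u : ℝ → ℝ → ℝ) (k : ℂ) : Prop :=
  ∃ Φ : ℝ → ℝ → Mat3, IsEigenfunction T u k Φ ∧
    ∀ Ψ : ℝ → ℝ → Mat3, IsEigenfunction T u k Ψ → ∀ x t : ℝ, (x, t) ∈ Omega T → Ψ x t = Φ x t

open Classical in
/-- `Φ_n(x, t, k)` for `k ∈ D n` outside the singular set; `0` for all other `k`. -/
def Phi (T : ℝ) (u : ℝ → ℝ → ℝ) (n : Fin 18) (x t : ℝ) (k : ℂ) : Mat3 :=
  if h : k ∈ D n ∧ WellDefined T u k then h.2.choose x t else 0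

open Classical in
/-- The sectionally defined function `Φ_*`, equal to `Φ_n` on `D n`; see `PhiStar_eq`. -/
def PhiStar (T : ℝ) (u : ℝ → ℝ → ℝ) (x t : ℝ) (k : ℂ) : Mat3 :=
  if h : ∃ n, k ∈ D n then Phi T u h.choose x t k else 0

theorem PhiStar_eq (T : ℝ) (u : ℝ → ℝ → ℝ) (n : Fin 18) (x t : ℝ) (k : ℂ) (hk : k ∈ D n) :
    PhiStar T u x t k = Phi T u n x t k := by
  have h : ∃ n, k ∈ D n := ⟨n, hk⟩
  have h' : k ∈ D h.choose := h.choose_spec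
  by_cases hw : WellDefined T u k
  · simp only [PhiStar, Phi]
    rw [dif_pos h, dif_pos ⟨h', hw⟩, dif_pos ⟨hk, hw⟩]
  · simp [PhiStar, Phi, hw]

/-- The domain of `Φ_*`: the points of the sets `D n` at which the eigenfunction is well-defined. -/
def domain (T : ℝ) (u : ℝ → ℝ → ℝ) : Set ℂ := {k | (∃ n, k ∈ D n) ∧ WellDefined T u k}

/-- The matrix `𝓐`. -/
def A : Mat3 := !![0, 0, 1; 1, 0, 0; 0, 1, 0]

/-- The matrix `𝓑`. -/
def B : Mat3 := !![0, 1, 0; 1, 0, 0; 0, 0, 1]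

end DPHalfLine

end

namespace DPHalfLine

/-! Each of `k ↦ ωk`, `k ↦ conj k`, `k ↦ 1/k` permutes the pairs `(l_j, z_j)`, up to complex
conjugation in the second case. As `u` and `q` are real, both potentials, the phases and the
contours (chosen by real parts) undergo the same permutation and conjugation. So relabelling an
eigenfunction at `k` gives one at `k'` (`isEigenfunction`). The inverse relabelling carries
uniqueness across (`wellDefined`), and uniqueness identifies `Φ_*(k)` with the relabelled `Φ_*(k')`
(`PhiStar_eq_relabel`). The list of 18 regions is closed under permuting indices
(`exists_order_relabel`), so the domain is preserved. Conjugation by `A` or `B` is the relabelling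
in matrix form. -/

/-- The index permutation `σ`, combined with the real automorphism `τ` of `ℂ`, carries the spectral
data at `k` to those at `k'`. -/
structure IsSpectralSymmetry (τ : ℂ →ₐ[ℝ] ℂ) (σ : Equiv.Perm (Fin 3)) (k k' : ℂ) : Prop where
  l_eq : ∀ j, l k' j = τ (l k (σ j))
  z_eq : ∀ j, z k' j = τ (z k (σ j))
  lam_eq : lam k' = τ (lam k)

/-- The action of an index permutation and a real automorphism of `ℂ` on matrices. -/
noncomputable def relabel (τ : ℂ →ₐ[ℝ] ℂ) (σ : Equiv.Perm (Fin 3)) (M : Mat3) : Mat3 :=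
  (M.map τ).submatrix σ σ

/-! ### Real automorphisms of ℂ: the identity and conjugation -/

section RealAutomorphism

variable (τ : ℂ →ₐ[ℝ] ℂ)

theorem algHom_apply_apply (a : ℂ) : τ (τ a) = a := by
  rcases Complex.real_algHom_eq_id_or_conj τ with rfl | rfl <;> simp

theorem algHom_re (a : ℂ) : (τ a).re = a.re := by
  rcases Complex.real_algHom_eq_id_or_conj τ with rfl | rfl <;> simp

theorem algHom_norm (a : ℂ) : ‖τ a‖ = ‖a‖ := by
  rcases Complex.real_algHom_eq_id_or_conj τ with rfl | rfl <;> simp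

theorem algHom_exp (a : ℂ) : τ (Complex.exp a) = Complex.exp (τ a) := by
  rcases Complex.real_algHom_eq_id_or_conj τ with rfl | rfl <;> simp [Complex.exp_conj]

theorem algHom_hasDerivWithinAt {f : ℝ → ℂ} {f' : ℂ} {s : Set ℝ} {x : ℝ}
    (h : HasDerivWithinAt f f' s x) : HasDerivWithinAt (fun y => τ (f y)) (τ f') s x :=
  (LinearMap.toContinuousLinearMap τ.toLinearMap).hasFDerivAt.comp_hasDerivWithinAt x h

theorem algHom_integrable {α : Type*} [MeasurableSpace α] {μ : MeasureTheory.Measure α}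
    {f : α → ℂ} (h : MeasureTheory.Integrable f μ) :
    MeasureTheory.Integrable (fun a => τ (f a)) μ :=
  (LinearMap.toContinuousLinearMap τ.toLinearMap).integrable_comp h

theorem algHom_integral {α : Type*} [MeasurableSpace α] {μ : MeasureTheory.Measure α}
    (f : α → ℂ) : ∫ a, τ (f a) ∂μ = τ (∫ a, f a ∂μ) := by
  rcases Complex.real_algHom_eq_id_or_conj τ with rfl | rfl
  · simp
  · simpa using integral_conj (f := f)

theorem algHom_intervalIntegral (f : ℝ → ℂ) (a b : ℝ) :
    ∫ x in a..b, τ (f x) = τ (∫ x in a..b, f x) := by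
  simp only [intervalIntegral, algHom_integral, map_sub]

theorem algHom_intervalIntegrable {f : ℝ → ℂ} {a b : ℝ}
    (h : IntervalIntegrable f MeasureTheory.volume a b) :
    IntervalIntegrable (fun x => τ (f x)) MeasureTheory.volume a b :=
  ⟨algHom_integrable τ h.1, algHom_integrable τ h.2⟩

theorem contourIntegral_algHom (T : ℝ) (γ : Contour) (f g : ℝ → ℝ → ℂ) (x t : ℝ) :
    contourIntegral T γ (fun x t => τ (f x t)) (fun x t => τ (g x t)) x t =
      τ (contourIntegral T γ f g x t) := by
  cases γ <;> simp only [contourIntegral, algHom_intervalIntegral, algHom_integral, map_add,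
    map_neg]

theorem ContourIntegrable.algHom {T : ℝ} {γ : Contour} {f g : ℝ → ℝ → ℂ} {x t : ℝ}
    (h : ContourIntegrable T γ f g x t) :
    ContourIntegrable T γ (fun x t => τ (f x t)) (fun x t => τ (g x t)) x t := by
  cases γ
  · exact ⟨algHom_intervalIntegrable τ h.1, algHom_intervalIntegrable τ h.2⟩
  · exact ⟨algHom_intervalIntegrable τ h.1, algHom_intervalIntegrable τ h.2⟩
  · exact algHom_integrable τ h

/-- Ring homomorphisms commute with determinant and adjugate. Singular `M` is covered because `0⁻¹ =
0`, so invertibility of `P k` never has to be checked. -/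
theorem map_nonsing_inv_algHom (M : Mat3) : M⁻¹.map τ = (M.map τ)⁻¹ := by
  have hdet : (M.map τ).det = τ M.det := (RingHom.map_det τ.toRingHom M).symm
  have hadj : (M.map τ).adjugate = M.adjugate.map τ :=
    (RingHom.map_adjugate τ.toRingHom M).symm
  ext i j
  simp [Matrix.inv_def, hdet, hadj, Ring.inverse_eq_inv']

end RealAutomorphism

/-! ### Relabelling of matrices -/

section Relabel

variable (τ : ℂ →ₐ[ℝ] ℂ) (σ : Equiv.Perm (Fin 3))

@[simp]
theorem relabel_apply (M : Mat3) (i j : Fin 3) : relabel τ σ M i j = τ (M (σ i) (σ j)) := rfl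

theorem relabel_mul (M N : Mat3) : relabel τ σ (M * N) = relabel τ σ M * relabel τ σ N := by
  ext i j
  simp only [relabel_apply, Matrix.mul_apply, map_sum, map_mul]
  exact (Equiv.sum_comp σ fun m => τ (M (σ i) m) * τ (N m (σ j))).symm

theorem relabel_add (M N : Mat3) : relabel τ σ (M + N) = relabel τ σ M + relabel τ σ N := by
  ext i j; simp

theorem relabel_sub (M N : Mat3) : relabel τ σ (M - N) = relabel τ σ M - relabel τ σ N := by
  ext i j; simp

theorem relabel_one : relabel τ σ 1 = 1 := by
  ext i j
  simp [Matrix.one_apply, apply_ite τ]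

theorem relabel_diagonal (d : Fin 3 → ℂ) :
    relabel τ σ (Matrix.diagonal d) = Matrix.diagonal fun i => τ (d (σ i)) := by
  ext i j
  simp [Matrix.diagonal_apply, apply_ite τ]

theorem relabel_expHat (d : Fin 3 → ℂ) (M : Mat3) :
    relabel τ σ (expHat d M) = expHat (fun i => τ (d (σ i))) (relabel τ σ M) := by
  simp only [expHat, relabel_mul, relabel_diagonal, algHom_exp, map_neg]

theorem relabel_symm_relabel (M : Mat3) : relabel τ σ (relabel τ σ.symm M) = M := by
  ext i j
  simp [algHom_apply_apply]

/-- Permuting the columns of `X` permutes the rows of `X⁻¹`. The middle factor keeps its indices: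
for `X = P k` they count powers of `l_j`, not the `l_j` themselves. -/
theorem relabel_conjugate {X X' : Mat3} (hX : X' = (X.map τ).submatrix id σ) (M : Mat3) :
    X'⁻¹ * M.map τ * X' = relabel τ σ (X⁻¹ * M * X) := by
  have hinv : X'⁻¹ = (X⁻¹.map τ).submatrix σ id := by
    rw [hX, map_nonsing_inv_algHom]
    exact Matrix.inv_submatrix_equiv (X.map τ) (Equiv.refl _) σ
  rw [hinv, hX]
  ext i j
  simp [Matrix.mul_apply]

end Relabel

/-! ### Transport of the Lax pair and the integral equations -/

namespace IsSpectralSymmetry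

variable {τ : ℂ →ₐ[ℝ] ℂ} {σ : Equiv.Perm (Fin 3)} {k k' : ℂ}

/-- The same `τ` serves for the inverse, being an involution. -/
theorem symm (h : IsSpectralSymmetry τ σ k k') : IsSpectralSymmetry τ σ.symm k' k where
  l_eq j := by simp [h.l_eq, algHom_apply_apply]
  z_eq j := by simp [h.z_eq, algHom_apply_apply]
  lam_eq := by simp [h.lam_eq, algHom_apply_apply]

theorem P_eq (h : IsSpectralSymmetry τ σ k k') : P k' = ((P k).map τ).submatrix id σ := by
  ext i j
  simp [P, h.l_eq]

theorem V1_eq (h : IsSpectralSymmetry τ σ k k') (u : ℝ → ℝ → ℝ) (x t : ℝ) :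
    V1 u x t k' = relabel τ σ (V1 u x t k) := by
  rw [V1, V1, ← relabel_conjugate τ σ h.P_eq]
  congr 2
  ext i j
  -- Every entry is a real number or a real multiple of `λ`, so `τ` acts only through `λ`.
  fin_cases i <;> fin_cases j <;> simp [h.lam_eq]

theorem V2_eq (h : IsSpectralSymmetry τ σ k k') (u : ℝ → ℝ → ℝ) (x t : ℝ) :
    V2 u x t k' = relabel τ σ (V2 u x t k) := by
  rw [V2, V2, ← relabel_conjugate τ σ h.P_eq]
  congr 2
  ext i j
  fin_cases i <;> fin_cases j <;> simp [h.lam_eq]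

theorem phase_eq (h : IsSpectralSymmetry τ σ k k') (x t : ℝ) :
    phase x t k' = fun i => τ (phase x t k (σ i)) := by
  ext i
  simp [phase, h.l_eq, h.z_eq]

theorem contour_eq (h : IsSpectralSymmetry τ σ k k') (i j : Fin 3) :
    contour k' i j = contour k (σ i) (σ j) := by
  simp only [contour, h.l_eq, h.z_eq, algHom_re]

theorem W1_eq (h : IsSpectralSymmetry τ σ k k') (u : ℝ → ℝ → ℝ) (Φ : ℝ → ℝ → Mat3) (x t : ℝ) :
    W1 u (fun x t => relabel τ σ (Φ x t)) x t k' = relabel τ σ (W1 u Φ x t k) := by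
  rw [W1, W1, relabel_expHat, relabel_mul, h.V1_eq, h.phase_eq]
  congr 1
  ext i
  simp

theorem W2_eq (h : IsSpectralSymmetry τ σ k k') (u : ℝ → ℝ → ℝ) (Φ : ℝ → ℝ → Mat3) (x t : ℝ) :
    W2 u (fun x t => relabel τ σ (Φ x t)) x t k' = relabel τ σ (W2 u Φ x t k) := by
  rw [W2, W2, relabel_expHat, relabel_mul, h.V2_eq, h.phase_eq]
  congr 1
  ext i
  simp

theorem isEigenfunction (h : IsSpectralSymmetry τ σ k k') {T : ℝ} {u : ℝ → ℝ → ℝ}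
    {Φ : ℝ → ℝ → Mat3} (hΦ : IsEigenfunction T u k Φ) :
    IsEigenfunction T u k' fun x t => relabel τ σ (Φ x t) where
  lax_x x t hxt i j := by
    have hl : Matrix.diagonal (l k') = relabel τ σ (Matrix.diagonal (l k)) := by
      rw [relabel_diagonal, funext h.l_eq]
    rw [hl, h.V1_eq, ← relabel_mul, ← relabel_mul, ← relabel_mul, ← relabel_sub, ← relabel_add]
    exact algHom_hasDerivWithinAt τ (hΦ.lax_x x t hxt (σ i) (σ j))
  lax_t x t hxt i j := by
    have hz : Matrix.diagonal (z k') = relabel τ σ (Matrix.diagonal (z k)) := by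
      rw [relabel_diagonal, funext h.z_eq]
    rw [hz, h.V2_eq, ← relabel_mul, ← relabel_mul, ← relabel_mul, ← relabel_sub, ← relabel_add]
    exact algHom_hasDerivWithinAt τ (hΦ.lax_t x t hxt (σ i) (σ j))
  bounded t ht := by
    obtain ⟨C, hC⟩ := hΦ.bounded t ht
    exact ⟨C, fun x hx i j => (algHom_norm τ _).trans_le (hC x hx (σ i) (σ j))⟩
  integrable x t hxt i j := by
    simp only [h.W1_eq, h.W2_eq, h.phase_eq x t, ← relabel_expHat, h.contour_eq]
    exact (hΦ.integrable x t hxt (σ i) (σ j)).algHom τ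
  integral_eq x t hxt i j := by
    simp only [h.W1_eq, h.W2_eq, h.phase_eq x t, ← relabel_expHat, h.contour_eq]
    rw [← relabel_one τ σ]
    simp only [relabel_apply, contourIntegral_algHom, ← map_add]
    rw [← hΦ.integral_eq x t hxt (σ i) (σ j)]

theorem wellDefined (h : IsSpectralSymmetry τ σ k k') {T : ℝ} {u : ℝ → ℝ → ℝ}
    (hw : WellDefined T u k) : WellDefined T u k' := by
  obtain ⟨Φ, hΦ, huniq⟩ := hw
  refine ⟨_, h.isEigenfunction hΦ, fun Ψ hΨ x t hxt => ?_⟩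
  -- `Ψ` pulled back to `k` must be `Φ`; pushing forward again recovers `Ψ`.
  rw [← huniq _ (h.symm.isEigenfunction hΨ) x t hxt, relabel_symm_relabel]

theorem ordered_iff {f f' : Fin 3 → ℂ} (hf : ∀ j, f' j = τ (f (σ j)))
    (p : Fin 3 × Fin 3 × Fin 3) :
    Ordered f' p ↔ Ordered f (Prod.map σ (Prod.map σ σ) p) := by
  simp only [Ordered, hf, algHom_re, Prod.map_fst, Prod.map_snd]

end IsSpectralSymmetry

/-- The list of orderings defining `D₁, …, D₁₈` is invariant under relabelling the indices. -/
theorem exists_order_relabel : ∀ (σ : Equiv.Perm (Fin 3)) (n : Fin 18), ∃ m : Fin 18,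
    Prod.map σ (Prod.map σ σ) (lOrder m) = lOrder n ∧
      Prod.map σ (Prod.map σ σ) (zOrder m) = zOrder n := by
  -- The 18 pairs are those whose `z`-order equals the `l`-order or differs from it by swapping two
  -- neighbouring positions. Permuting labels commutes with permuting positions.
  decide

/-- On its domain, `Φ_*` agrees with every eigenfunction. -/
theorem PhiStar_eq_of_isEigenfunction {T : ℝ} {u : ℝ → ℝ → ℝ} {k : ℂ} (hk : k ∈ domain T u)
    {Φ : ℝ → ℝ → Mat3} (hΦ : IsEigenfunction T u k Φ) {x t : ℝ} (hxt : (x, t) ∈ Omega T) :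
    PhiStar T u x t k = Φ x t := by
  obtain ⟨⟨n, hn⟩, hw⟩ := hk
  rw [PhiStar_eq T u n x t k hn, Phi, dif_pos ⟨hn, hw⟩]
  exact (hw.choose_spec.2 Φ hΦ x t hxt).symm

namespace IsSpectralSymmetry

variable {τ : ℂ →ₐ[ℝ] ℂ} {σ : Equiv.Perm (Fin 3)} {k k' : ℂ}

theorem mem_domain (h : IsSpectralSymmetry τ σ k k') {T : ℝ} {u : ℝ → ℝ → ℝ}
    (hk : k ∈ domain T u) : k' ∈ domain T u := by
  obtain ⟨⟨n, hn⟩, hw⟩ := hk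
  obtain ⟨m, hl, hz⟩ := exists_order_relabel σ n
  refine ⟨⟨m, (ordered_iff h.l_eq _).2 ?_, (ordered_iff h.z_eq _).2 ?_⟩, h.wellDefined hw⟩
  · rw [hl]; exact hn.1
  · rw [hz]; exact hn.2

/-- Both sides are values of eigenfunctions at `k`, hence equal by uniqueness. -/
theorem PhiStar_eq_relabel (h : IsSpectralSymmetry τ σ k k') {T : ℝ} {u : ℝ → ℝ → ℝ}
    (hk : k ∈ domain T u) {x t : ℝ} (hxt : (x, t) ∈ Omega T) :
    PhiStar T u x t k = relabel τ σ.symm (PhiStar T u x t k') := by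
  have hk' := h.mem_domain hk
  obtain ⟨Φ, hΦ, -⟩ := hk'.2
  rw [PhiStar_eq_of_isEigenfunction hk' hΦ hxt,
    PhiStar_eq_of_isEigenfunction hk (h.symm.isEigenfunction hΦ) hxt]

end IsSpectralSymmetry

/-! ### The three symmetries of the spectral data -/

theorem omega_pow_three : omega ^ 3 = 1 := by
  rw [omega, ← Complex.exp_nat_mul, ← Complex.exp_two_pi_mul_I]
  congr 1
  push_cast
  ring

theorem omega_inv : omega⁻¹ = omega ^ 2 :=
  inv_eq_of_mul_eq_one_right (by rw [← pow_succ', omega_pow_three])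

theorem conj_omega : conj omega = omega ^ 2 := by
  rw [← omega_inv, omega, ← Complex.exp_conj, ← Complex.exp_neg]
  congr 1
  simp [neg_div, Complex.conj_ofNat]

theorem omega_pow_val_add_one (j : Fin 3) :
    omega ^ ((j + 1 : Fin 3).val + 1) = omega ^ (j.val + 1) * omega := by
  have h3 := omega_pow_three
  fin_cases j
  · simp [pow_succ]
  · simp [pow_succ]
  · simp [h3]

/-- Index `j` carries the exponent `j + 1`: the swap exchanges the mutually inverse `ω` and `ω²` and
fixes `ω³ = 1`. -/
theorem omega_pow_inv_swap (j : Fin 3) :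
    (omega ^ ((Equiv.swap (0 : Fin 3) 1 j).val + 1))⁻¹ = omega ^ (j.val + 1) := by
  have h4 : (omega ^ 2) ^ 2 = omega := by
    linear_combination omega * omega_pow_three
  fin_cases j
  · simp [← inv_pow, omega_inv, h4]
  · simp [omega_inv]
  · simp [Equiv.swap_apply_of_ne_of_ne, omega_pow_three]

theorem conj_omega_pow_swap (j : Fin 3) :
    conj (omega ^ ((Equiv.swap (0 : Fin 3) 1 j).val + 1)) = omega ^ (j.val + 1) := by
  rw [map_pow, conj_omega, ← omega_inv, inv_pow, omega_pow_inv_swap]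

/-- Multiplying `k` by `ω` shifts `ω^j k` to `ω^(j+1) k` and leaves `k³` unchanged. -/
theorem isSpectralSymmetry_omega_mul (k : ℂ) :
    IsSpectralSymmetry (AlgHom.id ℝ ℂ) (Equiv.addRight 1) k (omega * k) where
  l_eq j := by
    simp only [l, AlgHom.id_apply, Equiv.coe_addRight, omega_pow_val_add_one, mul_assoc]
  z_eq j := by
    simp only [z, AlgHom.id_apply, Equiv.coe_addRight, omega_pow_val_add_one, mul_assoc,
      mul_pow omega k 3, omega_pow_three, one_mul]
  lam_eq := by
    simp only [lam, AlgHom.id_apply, mul_pow, omega_pow_three, one_mul]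

theorem isSpectralSymmetry_conj (k : ℂ) :
    IsSpectralSymmetry Complex.conjAe.toAlgHom (Equiv.swap 0 1) k (conj k) where
  l_eq j := by
    have h := conj_omega_pow_swap j
    simp only [map_pow] at h
    simp [l, h]
  z_eq j := by
    have h := conj_omega_pow_swap j
    simp only [map_pow] at h
    simp [z, h]
  lam_eq := by simp [lam, Complex.conj_ofNat]

/-- `l_j` and `z_j` are invariant under `w ↦ 1/w` in `w = ω^j k`, so inverting `k` amounts to
replacing `ω^j` by `ω^(-j)`. With `1/0 = 0` this holds at `k = 0` too. -/
theorem isSpectralSymmetry_inv (k : ℂ) :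
    IsSpectralSymmetry (AlgHom.id ℝ ℂ) (Equiv.swap 0 1) k (1 / k) where
  l_eq j := by
    simp only [l, AlgHom.id_apply, ← omega_pow_inv_swap j, one_div, mul_inv, inv_inv]
    ring
  z_eq j := by
    simp only [z, AlgHom.id_apply, ← omega_pow_inv_swap j, one_div, mul_inv, inv_inv, inv_pow,
      mul_pow]
    ring
  lam_eq := by
    simp only [lam, AlgHom.id_apply, one_div, inv_pow, inv_inv]
    ring

/-! ### Relabelling as conjugation by `A` and `B` -/

theorem A_inv : A⁻¹ = !![0, 1, 0; 0, 0, 1; 1, 0, 0] := by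
  refine Matrix.inv_eq_right_inv ?_
  ext i j
  fin_cases i <;> fin_cases j <;> simp [A, Matrix.mul_apply, Fin.sum_univ_three]

/-- `A` is the permutation matrix of the shift `i ↦ i - 1`, the inverse of the one attached to `k ↦
ωk`. -/
theorem A_conjugate (M : Mat3) :
    A * M * A⁻¹ = relabel (AlgHom.id ℝ ℂ) (Equiv.addRight (1 : Fin 3)).symm M := by
  rw [A_inv]
  ext i j
  fin_cases i <;> fin_cases j <;>
    simp [A, Matrix.mul_apply, Matrix.vecMul, Fin.sum_univ_three] <;> rfl

theorem B_conjugate (τ : ℂ →ₐ[ℝ] ℂ) (M : Mat3) :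
    B * M.map τ * B = relabel τ (Equiv.swap (0 : Fin 3) 1).symm M := by
  ext i j
  fin_cases i <;> fin_cases j <;>
    simp [B, Matrix.mul_apply, Matrix.vecMul, Fin.sum_univ_three,
      Equiv.swap_apply_of_ne_of_ne] <;> rfl

end DPHalfLine

theorem mainTheorem8 (T : ℝ) (hT : 0 < T) (u : ℝ → ℝ → ℝ) (hu : DPHalfLine.IsDPSolution T u)
    (k : ℂ) (hk : k ∈ DPHalfLine.domain T u) :
    (DPHalfLine.omega * k ∈ DPHalfLine.domain T u ∧
      conj k ∈ DPHalfLine.domain T u ∧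
      1 / k ∈ DPHalfLine.domain T u) ∧
    ∀ x t : ℝ, (x, t) ∈ DPHalfLine.Omega T →
      DPHalfLine.PhiStar T u x t k =
          DPHalfLine.A * DPHalfLine.PhiStar T u x t (DPHalfLine.omega * k) * DPHalfLine.A⁻¹ ∧
      DPHalfLine.PhiStar T u x t k =
          DPHalfLine.B * (DPHalfLine.PhiStar T u x t (conj k)).map conj * DPHalfLine.B ∧
      DPHalfLine.PhiStar T u x t k =
          DPHalfLine.B * DPHalfLine.PhiStar T u x t (1 / k) * DPHalfLine.B := by
  have hω := DPHalfLine.isSpectralSymmetry_omega_mul k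
  have hc := DPHalfLine.isSpectralSymmetry_conj k
  have hi := DPHalfLine.isSpectralSymmetry_inv k
  refine ⟨⟨hω.mem_domain hk, hc.mem_domain hk, hi.mem_domain hk⟩, fun x t hxt => ⟨?_, ?_, ?_⟩⟩
  · rw [DPHalfLine.A_conjugate]
    exact hω.PhiStar_eq_relabel hk hxt
  · exact (hc.PhiStar_eq_relabel hk hxt).trans
      (DPHalfLine.B_conjugate Complex.conjAe.toAlgHom _).symm
  · exact (hi.PhiStar_eq_relabel hk hxt).trans
      (DPHalfLine.B_conjugate (AlgHom.id ℝ ℂ) _).symm
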